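/- Let $n \ge 3$ and $2 \le k \le n-1$, and let $\mathcal{I}$ be the set of all $k$-element subsets of $\{1,\dots,n\}$. For $I \in \mathcal{I}$ let $\mathbb{Z}^k_I \subset \mathbb{Z}^n$ be the set of integer linear combinations of the canonical vectors $e_i$, $i \in I$, and let $\pi_I : \mathbb{Z}^n \to \mathbb{Z}^k_I$ be the orthogonal projection. Given parameters $\mathbf{p} = (p_I)_{I \in \mathcal{I}} \in [0,1]^{\mathcal{I}}$, let $\omega_I = (\omega_I(u))_{u \in \mathbb{Z}^k_I}$, $I \in \mathcal{I}$, be independent Bernoulli site percolations: for each $I$ the variables $\omega_I(u) \in \{0,1\}$ are i.i.d. with mean $p_I$. Bernoulli $(n,k)$-hyperplane percolation is the random configuration $\omega(v) = \prod_{I \in \mathcal{I}} \omega_I(\pi_I(v))$, $v \in \mathbb{Z}^n$; let $\mathbb{P}_{\mathbf{p}}$ be its law on $\{0,1\}^{\mathbb{Z}^n}$. A site $v$ is open if $\omega(v) = 1$. Let $[o \leftrightarrow \infty]$ be the event that the origin $o$ belongs to an infinite connected component of open sites in the nearest-neighbour lattice $\mathbb{Z}^n$. Then the model undergoes a non-trivial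 phase transition, i.e. there are $\mathbf{p}$ with $p_I > 0$ for all $I$ and $\mathbb{P}_{\mathbf{p}}(o \leftrightarrow \infty) = 0$, and $\mathbf{q}$ with $q_I < 1$ for all $I$ and $\mathbb{P}_{\mathbf{q}}(o \leftrightarrow \infty) > 0$. More precisely: 1. there is $\varepsilon = \varepsilon(n,k) > 0$ such that $\mathbb{P}_{\mathbf{p}}(o \leftrightarrow \infty) > 0$ for every $\mathbf{p} \in [0,1]^{\mathcal{I}}$ with $p_I > 1 - \varepsilon$ for all $I \in \mathcal{I}$; 2. there is $\varepsilon = \varepsilon(n,k) > 0$ such that $\mathbb{P}_{\mathbf{p}}(o \leftrightarrow \infty) = 0$ for every $\mathbf{p} \in [0,1]^{\mathcal{I}}$ with $p_I < \varepsilon$ for all $I \in \mathcal{I}$. -/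

import Mathlib

open MeasureTheory ProbabilityTheory

namespace HyperplanePercolation

/-- The index set of all `k`-element subsets `I` of `[n]`. -/
abbrev Index (n k : ℕ) : Type := {I : Finset (Fin n) // I.card = k}

/-- The coordinate hyperplane `ℤ^k_I` in `ℤ^n`: the integer combinations of the canonical
vectors `e_i`, `i ∈ I`, i.e. the integer vectors whose coordinates outside `I` vanish. -/
abbrev CoordPlane {n : ℕ} (I : Finset (Fin n)) : Type :=
  {x : Fin n → ℤ // ∀ i, i ∉ I → x i = 0}

/-- The orthogonal projection `π_I` of `ℤ^n` onto `ℤ^k_I`. -/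
def proj {n : ℕ} (I : Finset (Fin n)) (v : Fin n → ℤ) : CoordPlane I :=
  ⟨fun i => if i ∈ I then v i else 0, fun _ hi => if_neg hi⟩

/-- The law of Bernoulli site percolation with parameter `p` on a set of sites `S`: the
states of the sites (`true` for `1`, i.e. open; `false` for `0`, i.e. removed) are i.i.d.
and each of them is open with probability `p`. -/
noncomputable def sitePerc (S : Type) (p : unitInterval) : Measure (S → Bool) :=
  Measure.infinitePi fun _ : S => bernoulliMeasure true false p

/-- The configuration `ω(v) = ∏_I ω_I(π_I v)` on `ℤ^n`: the site `v` is open if and only if,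
for every `I`, its projection to `ℤ^k_I` is open in `ω_I`. -/
def config {n k : ℕ} (ω : (I : Index n k) → CoordPlane I.1 → Bool) : (Fin n → ℤ) → Bool :=
  fun v => decide (∀ I : Index n k, ω I (proj I.1 v) = true)

/-- The law `ℙ_𝐩` on `{0,1}^(ℤ^n)` of Bernoulli `(n,k)`-hyperplane percolation: the
processes `ω_I` are independent Bernoulli site percolations with parameters `p_I`. -/
noncomputable def law {n k : ℕ} (p : Index n k → unitInterval) :
    Measure ((Fin n → ℤ) → Bool) :=
  (Measure.pi fun I : Index n k => sitePerc (CoordPlane I.1) (p I)).map config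

/-- The `ℤ^n`-lattice: the edges join the points at distance one. -/
def lattice (n : ℕ) : SimpleGraph (Fin n → ℤ) where
  Adj x y := ∑ i, |x i - y i| = 1
  symm := ⟨fun x y h => by simpa only [abs_sub_comm] using h⟩
  loopless := ⟨fun x h => by simp at h⟩

/-- The open cluster of `x`: the sites `y` joined to `x` by a path in `ℤ^n` all of whose
sites, the endpoints included, are open. It is empty if `x` itself is not open. -/
def cluster {n : ℕ} (η : (Fin n → ℤ) → Bool) (x : Fin n → ℤ) : Set (Fin n → ℤ) :=
  {y | ∃ w : (lattice n).Walk x y, w.IsPath ∧ ∀ z ∈ w.support, η z = true}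

/-- The event that the origin belongs to an infinite open cluster. -/
def originToInfinity (n : ℕ) : Set ((Fin n → ℤ) → Bool) :=
  {η | (cluster η 0).Infinite}

/-- Bernoulli `(n,k)`-hyperplane percolation exhibits a non-trivial phase transition: there is
no percolation for some parameters that are all positive, and there is percolation with
positive probability for some parameters that are all less than `1`. -/
def NontrivialPhaseTransition (n k : ℕ) : Prop :=
  (∃ p : Index n k → unitInterval, (∀ I, 0 < p I) ∧ law p (originToInfinity n) = 0) ∧
    ∃ q : Index n k → unitInterval, (∀ I, q I < 1) ∧ 0 < law q (originToInfinity n)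

/-- The configuration depends measurably on the `ω_I`, so the push-forward in `law` is a
genuine one. -/
theorem measurable_config {n k : ℕ} :
    Measurable (config : ((I : Index n k) → CoordPlane I.1 → Bool) → (Fin n → ℤ) → Bool) := by
  refine measurable_pi_lambda _ fun v => measurable_to_bool ?_
  have h : (fun ω : (I : Index n k) → CoordPlane I.1 → Bool => config ω v) ⁻¹' {true} =
      ⋂ I : Index n k, {ω | ω I (proj I.1 v) = true} := by
    ext ω
    simp [config]
  rw [h]
  refine MeasurableSet.iInter fun I => ?_
  have hm : Measurable fun ω : (I : Index n k) → CoordPlane I.1 → Bool => ω I (proj I.1 v) :=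
    (measurable_pi_apply _).comp (measurable_pi_apply I)
  exact hm (measurableSet_singleton true)

instance (S : Type) (p : unitInterval) : IsProbabilityMeasure (sitePerc S p) := by
  unfold sitePerc
  infer_instance

instance {n k : ℕ} (p : Index n k → unitInterval) : IsProbabilityMeasure (law p) :=
  Measure.isProbabilityMeasure_map measurable_config.aemeasurable

end HyperplanePercolation

/-!
Subcritical phase: an infinite open cluster has an infinite projection to some coordinate plane, and
the projection is contained in an open cluster of the percolation on that plane. There an infinite
cluster contains open self-avoiding paths of every length, which a union bound excludes when the
parameter is small.

Supercritical phase: place cells of bounded size at the points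
`a • (1, …, 1) + b • (0, 1, …, n - 1)` for `(a, b)` in `ℕ²`. As `k ≥ 2` and two coordinates of such
a point determine `(a, b)`, distant cells depend on disjoint sets of variables, so that the cells
with a closed site form a sparse set with finite range of dependence. Call a box of one scale bad if
two distant sub-boxes of it are bad: the probability of being bad is essentially squared from each
scale to the next, and with positive probability no box at the origin is bad at any scale. Two good
neighbouring boxes have a row or column of good sub-boxes in common, so that they are connected, at
every scale.
-/

namespace HyperplanePercolation

section Renormalisation

variable {L r : ℕ} {B : Set (ℕ × ℕ)} {C : Setoid (ℕ × ℕ)} {x : ℕ × ℕ}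

/-- Two points of `ℕ²` are far apart if their `ℓ^∞` distance exceeds `r`. -/
def Far (r : ℕ) (x y : ℕ × ℕ) : Prop := r < Nat.dist x.1 y.1 ∨ r < Nat.dist x.2 y.2

/-- The sub-box in position `s` of the box `x`, when every box is cut into `L × L` sub-boxes. -/
def subBox (x : ℕ × ℕ) (s : Fin L × Fin L) : ℕ × ℕ := (L * x.1 + s.1, L * x.2 + s.2)

/-- One renormalisation step: given the set `B` of bad boxes of one level, a box of the next level
is bad if two far apart sub-boxes of it are bad. -/
def coarsen (r L : ℕ) (B : Set (ℕ × ℕ)) : Set (ℕ × ℕ) :=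
  {x | ∃ s t : Fin L × Fin L, Far r (subBox x s) (subBox x t) ∧ subBox x s ∈ B ∧ subBox x t ∈ B}

/-- No sub-box in row `j` of the box `x` is bad. -/
def FullRow (B : Set (ℕ × ℕ)) (x : ℕ × ℕ) (j : Fin L) : Prop := ∀ i : Fin L, subBox x (i, j) ∉ B

/-- No sub-box in column `i` of the box `x` is bad. -/
def FullColumn (B : Set (ℕ × ℕ)) (x : ℕ × ℕ) (i : Fin L) : Prop :=
  ∀ j : Fin L, subBox x (i, j) ∉ B

/-- The sub-box in position `s` of the box `x` is at the crossing of a full column and a full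
row; such sub-boxes represent `x` in the renormalisation. -/
def IsCrossing (B : Set (ℕ × ℕ)) (x : ℕ × ℕ) (s : Fin L × Fin L) : Prop :=
  FullColumn B x s.1 ∧ FullRow B x s.2

/-- Neighbouring boxes of `ℕ²` outside the bad set `B` are equivalent under `C`. -/
structure LinksNeighbours (C : Setoid (ℕ × ℕ)) (B : Set (ℕ × ℕ)) : Prop where
  right : ∀ a b, (a, b) ∉ B → (a + 1, b) ∉ B → C (a, b) (a + 1, b)
  up : ∀ a b, (a, b) ∉ B → (a, b + 1) ∉ B → C (a, b) (a, b + 1)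

theorem LinksNeighbours.swap (h : LinksNeighbours C B) :
    LinksNeighbours (C.comap Prod.swap) (Prod.swap ⁻¹' B) where
  right a b := h.up b a
  up a b := h.right b a

theorem swap_mem_coarsen_swap : x.swap ∈ coarsen r L (Prod.swap ⁻¹' B) ↔ x ∈ coarsen r L B :=
  ⟨fun ⟨s, t, hst, hs, ht⟩ => ⟨s.swap, t.swap, hst.symm, hs, ht⟩,
    fun ⟨s, t, hst, hs, ht⟩ => ⟨s.swap, t.swap, hst.symm, hs, ht⟩⟩

theorem exists_notMem_and_notMem_of_dist_le (hL : 2 * r + 3 ≤ L) {P Q : Set (Fin L)}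
    (hP : ∀ i ∈ P, ∀ j ∈ P, Nat.dist i j ≤ r) (hQ : ∀ i ∈ Q, ∀ j ∈ Q, Nat.dist i j ≤ r) :
    ∃ i, i ∉ P ∧ i ∉ Q := by
  -- Each of the two sets contains at most one of the three positions `0`, `r + 1`, `2 * r + 2`.
  have not_both : ∀ {S : Set (Fin L)}, (∀ i ∈ S, ∀ j ∈ S, Nat.dist i j ≤ r) →
      ∀ {i j : Fin L}, (i : ℕ) + r < j → ¬ (i ∈ S ∧ j ∈ S) := by
    rintro S hS i j hij ⟨hi, hj⟩
    have := hS i hi j hj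
    rw [Nat.dist_eq_sub_of_le (by omega)] at this
    omega
  obtain ⟨first, hfirst⟩ : ∃ i : Fin L, (i : ℕ) = 0 := ⟨⟨0, by omega⟩, rfl⟩
  obtain ⟨middle, hmiddle⟩ : ∃ i : Fin L, (i : ℕ) = r + 1 := ⟨⟨r + 1, by omega⟩, rfl⟩
  obtain ⟨last, hlast⟩ : ∃ i : Fin L, (i : ℕ) = 2 * r + 2 := ⟨⟨2 * r + 2, by omega⟩, rfl⟩
  by_contra! h
  have cover : ∀ i, i ∈ P ∨ i ∈ Q := fun i => or_iff_not_imp_left.2 (h i)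
  rcases cover first with h₀ | h₀ <;> rcases cover middle with h₁ | h₁ <;>
    rcases cover last with h₂ | h₂ <;>
    first
    | exact not_both ‹_› (by omega) ⟨h₀, h₁⟩
    | exact not_both ‹_› (by omega) ⟨h₀, h₂⟩
    | exact not_both ‹_› (by omega) ⟨h₁, h₂⟩

theorem dist_le_of_not_fullRow (hx : x ∉ coarsen r L B) {i j : Fin L} (hi : ¬ FullRow B x i)
    (hj : ¬ FullRow B x j) : Nat.dist i j ≤ r := by
  simp only [FullRow, not_forall, not_not] at hi hj
  obtain ⟨a, ha⟩ := hi
  obtain ⟨b, hb⟩ := hj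
  by_contra! hij
  exact hx ⟨(a, i), (b, j), Or.inr (by simpa [subBox, Nat.dist_add_add_left] using hij), ha, hb⟩

theorem exists_common_fullRow (hL : 2 * r + 3 ≤ L) {y : ℕ × ℕ} (hx : x ∉ coarsen r L B)
    (hy : y ∉ coarsen r L B) : ∃ j : Fin L, FullRow B x j ∧ FullRow B y j := by
  simpa using exists_notMem_and_notMem_of_dist_le hL
    (P := {j | ¬ FullRow B x j}) (Q := {j | ¬ FullRow B y j})
    (fun _ hi _ hj => dist_le_of_not_fullRow hx hi hj)
    (fun _ hi _ hj => dist_le_of_not_fullRow hy hi hj)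

theorem exists_isCrossing (hL : 2 * r + 3 ≤ L) (hx : x ∉ coarsen r L B) :
    ∃ s : Fin L × Fin L, IsCrossing B x s := by
  obtain ⟨j, hj, -⟩ := exists_common_fullRow hL hx hx
  have hx' := mt swap_mem_coarsen_swap.1 hx
  obtain ⟨i, hi, -⟩ := exists_common_fullRow hL hx' hx'
  exact ⟨(i, j), hi, hj⟩

theorem rel_of_forall_rel_succ {α : Type*} (C : Setoid α) {f : Fin L → α}
    (h : ∀ (i : ℕ) (hi : i + 1 < L), C (f ⟨i, by omega⟩) (f ⟨i + 1, hi⟩)) (i j : Fin L) :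
    C (f i) (f j) := by
  have from_zero : ∀ (k : ℕ) (hk : k < L), C (f ⟨0, by omega⟩) (f ⟨k, hk⟩) := by
    intro k
    induction k with
    | zero => exact fun _ => C.refl _
    | succ k ih => exact fun hk => C.trans (ih (by omega)) (h k hk)
  exact C.trans (C.symm (from_zero i i.2)) (from_zero j j.2)

theorem FullRow.rel {j : Fin L} (hj : FullRow B x j) (hC : LinksNeighbours C B) (i i' : Fin L) :
    C (subBox x (i, j)) (subBox x (i', j)) :=
  rel_of_forall_rel_succ C (f := fun i => subBox x (i, j)) (fun i hi => hC.right _ _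
    (hj ⟨i, by omega⟩) (hj ⟨i + 1, hi⟩)) i i'

theorem FullColumn.rel {i : Fin L} (hi : FullColumn B x i) (hC : LinksNeighbours C B)
    (j j' : Fin L) : C (subBox x (i, j)) (subBox x (i, j')) :=
  FullRow.rel (B := Prod.swap ⁻¹' B) (x := x.swap)
    (show FullRow (Prod.swap ⁻¹' B) x.swap i from hi) hC.swap j j'

theorem IsCrossing.rel_of_fullRow {s : Fin L × Fin L} {j : Fin L} (hs : IsCrossing B x s)
    (hC : LinksNeighbours C B) (hj : FullRow B x j) (i : Fin L) :
    C (subBox x s) (subBox x (i, j)) :=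
  C.trans (hs.1.rel hC s.2 j) (hj.rel hC s.1 i)

theorem rel_subBox_of_isCrossing (hL : 2 * r + 3 ≤ L) (hC : LinksNeighbours C B) {a b : ℕ}
    (hx : (a, b) ∉ coarsen r L B) (hy : (a + 1, b) ∉ coarsen r L B) {s t : Fin L × Fin L}
    (hs : IsCrossing B (a, b) s) (ht : IsCrossing B (a + 1, b) t) :
    C (subBox (a, b) s) (subBox (a + 1, b) t) := by
  obtain ⟨j, hjx, hjy⟩ := exists_common_fullRow hL hx hy
  have hfirst : subBox (a + 1, b) (⟨0, by omega⟩, j) = (L * a + (L - 1) + 1, L * b + j) := by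
    simp only [subBox, Prod.mk.injEq, and_true, mul_add]
    omega
  have across :
      C (subBox (a, b) (⟨L - 1, by omega⟩, j)) (subBox (a + 1, b) (⟨0, by omega⟩, j)) := by
    rw [hfirst]
    exact hC.right _ _ (hjx _) (hfirst ▸ hjy _)
  exact C.trans (hs.rel_of_fullRow hC hjx _)
    (C.trans across (C.symm (ht.rel_of_fullRow hC hjy _)))

theorem exists_linksNeighbours_coarsen (hL : 2 * r + 3 ≤ L) (hC : LinksNeighbours C B) :
    ∃ ρ : ℕ × ℕ → Fin L × Fin L,
      LinksNeighbours (C.comap fun x => subBox x (ρ x)) (coarsen r L B) := by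
  have exists_position : ∀ x, ∃ s : Fin L × Fin L, x ∉ coarsen r L B → IsCrossing B x s := by
    intro x
    by_cases hx : x ∈ coarsen r L B
    · exact ⟨(⟨0, by omega⟩, ⟨0, by omega⟩), fun h => absurd hx h⟩
    · exact (exists_isCrossing hL hx).imp fun _ hs _ => hs
  choose ρ hρ using exists_position
  refine ⟨ρ, fun a b hx hy => rel_subBox_of_isCrossing hL hC hx hy (hρ _ hx) (hρ _ hy),
    fun a b hx hy => ?_⟩
  exact rel_subBox_of_isCrossing hL hC.swap
    (mt (swap_mem_coarsen_swap (x := (a, b))).1 hx)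
    (mt (swap_mem_coarsen_swap (x := (a, b + 1))).1 hy)
    (s := (ρ (a, b)).swap) (t := (ρ (a, b + 1)).swap)
    (hρ _ hx).symm (hρ _ hy).symm

theorem exists_pow_le_rel_zero (hL : 2 * r + 3 ≤ L) (N : ℕ) :
    ∀ {B : Set (ℕ × ℕ)} {C : Setoid (ℕ × ℕ)}, LinksNeighbours C B →
      (∀ M ≤ N, ∀ s : Fin L × Fin L, subBox 0 s ∉ (coarsen r L)^[M] B) →
      ∃ c : ℕ × ℕ, L ^ N ≤ c.1 ∧ C 0 c := by
  induction N with
  | zero =>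
    intro B C hC hB
    have hrow : FullRow B 0 (⟨0, by omega⟩ : Fin L) := fun i => hB 0 le_rfl (i, ⟨0, by omega⟩)
    refine ⟨(1, 0), by simp, ?_⟩
    simpa [subBox, ← Prod.zero_eq_mk] using
      hrow.rel hC (⟨0, by omega⟩ : Fin L) (⟨1, by omega⟩ : Fin L)
  | succ N ih =>
    intro B C hC hB
    obtain ⟨ρ, hρ⟩ := exists_linksNeighbours_coarsen hL hC
    obtain ⟨c, hc, hrel⟩ := ih hρ fun M hM => hB (M + 1) (by omega)
    refine ⟨subBox c (ρ c), ?_, C.trans ?_ hrel⟩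
    · calc L ^ (N + 1) = L * L ^ N := pow_succ' L N
        _ ≤ L * c.1 + (ρ c).1 := le_add_right (Nat.mul_le_mul_left L hc)
    · have hgood : ∀ s : Fin L × Fin L, subBox 0 s ∉ B := hB 0 (Nat.zero_le _)
      have hcross : IsCrossing B 0 ((⟨0, by omega⟩ : Fin L), (⟨0, by omega⟩ : Fin L)) :=
        ⟨fun _ => hgood _, fun _ => hgood _⟩
      exact hcross.rel_of_fullRow hC (fun _ => hgood _) _

theorem infinite_setOf_rel_zero (hL : 2 * r + 3 ≤ L) (hC : LinksNeighbours C B)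
    (hB : ∀ M, ∀ s : Fin L × Fin L, subBox 0 s ∉ (coarsen r L)^[M] B) :
    {c | C 0 c}.Infinite := by
  refine Set.Infinite.of_image Prod.fst (Set.infinite_of_forall_exists_gt fun N => ?_)
  obtain ⟨c, hc, hrel⟩ := exists_pow_le_rel_zero hL N hC fun M _ => hB M
  exact ⟨c.1, ⟨c, hrel, rfl⟩, (Nat.lt_pow_self (by omega)).trans_le hc⟩

end Renormalisation

section RandomBoxes

open scoped ENNReal

variable {Ω : Type*} {mΩ : MeasurableSpace Ω} {μ : Measure Ω} {r L : ℕ} {A : Ω → Set (ℕ × ℕ)}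

/-- A random subset `A` of `ℕ²` is `r`-dependent if its traces on any two sets of points at mutual
distance more than `r` are independent. -/
def IsDependent (r : ℕ) (A : Ω → Set (ℕ × ℕ)) (μ : Measure Ω) : Prop :=
  ∀ X Y : Set (ℕ × ℕ), (∀ x ∈ X, ∀ y ∈ Y, Far r x y) →
    IndepFun (fun ω (x : X) => (x : ℕ × ℕ) ∈ A ω) (fun ω (y : Y) => (y : ℕ × ℕ) ∈ A ω) μ

theorem IsDependent.measure_inter (h : IsDependent r A μ) {x y : ℕ × ℕ} (hxy : Far r x y) :
    μ {ω | x ∈ A ω ∧ y ∈ A ω} = μ {ω | x ∈ A ω} * μ {ω | y ∈ A ω} := by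
  have hind := h {x} {y} (by simpa using hxy)
  exact hind.measure_inter_preimage_eq_mul {g | g ⟨x, rfl⟩} {g | g ⟨y, rfl⟩}
    (measurableSet_setOfPred.2 (measurable_pi_apply _))
    (measurableSet_setOfPred.2 (measurable_pi_apply _))

theorem far_subBox_subBox {x y : ℕ × ℕ} (h : Far r x y) (s t : Fin L × Fin L) :
    Far r (subBox x s) (subBox y t) := by
  have stretch : ∀ {a b : ℕ}, r < Nat.dist a b → ∀ i j : Fin L,
      r < Nat.dist (L * a + i) (L * b + j) := by
    have of_lt : ∀ {a b : ℕ}, a + r < b → ∀ i j : Fin L, L * a + i + r < L * b + j := by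
      intro a b hab i j
      nlinarith [i.2, Nat.zero_le j, Nat.mul_le_mul_left L hab]
    intro a b hab i j
    rcases le_total a b with hle | hle
    · rw [Nat.dist_eq_sub_of_le hle] at hab
      have := of_lt (show a + r < b by omega) i j
      rw [Nat.dist_eq_sub_of_le (by omega)]
      omega
    · rw [Nat.dist_eq_sub_of_le_right hle] at hab
      have := of_lt (show b + r < a by omega) j i
      rw [Nat.dist_eq_sub_of_le_right (by omega)]
      omega
  exact h.imp (fun h => stretch h _ _) fun h => stretch h _ _

theorem isDependent_coarsen (h : IsDependent r A μ) :
    IsDependent r (fun ω => coarsen r L (A ω)) μ := by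
  -- Whether `x` is bad is a function of the states of its sub-boxes only.
  let subBoxes (X : Set (ℕ × ℕ)) : Set (ℕ × ℕ) :=
    {z | ∃ x : X, ∃ s : Fin L × Fin L, z = subBox x s}
  let coarse (X : Set (ℕ × ℕ)) (g : subBoxes X → Prop) (x : X) : Prop :=
    ∃ s t : Fin L × Fin L, Far r (subBox x.1 s) (subBox x t) ∧
      g ⟨subBox x s, x, s, rfl⟩ ∧ g ⟨subBox x t, x, t, rfl⟩
  have measurable_coarse : ∀ X, Measurable (coarse X) := fun X =>
    measurable_pi_lambda _ fun x => Measurable.exists fun s => Measurable.exists fun t =>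
      measurable_const.and ((measurable_pi_apply _).and (measurable_pi_apply _))
  intro X Y hXY
  refine (h (subBoxes X) (subBoxes Y) ?_).comp (measurable_coarse X) (measurable_coarse Y)
  rintro _ ⟨x, s, rfl⟩ _ ⟨y, t, rfl⟩
  exact far_subBox_subBox (hXY x x.2 y y.2) s t

theorem IsDependent.measure_mem_coarsen_le (h : IsDependent r A μ) {q : ℝ≥0∞}
    (hq : ∀ x, μ {ω | x ∈ A ω} ≤ q) (x : ℕ × ℕ) :
    μ {ω | x ∈ coarsen r L (A ω)} ≤ (L : ℝ≥0∞) ^ 4 * q ^ 2 := by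
  have pair : ∀ s t : Fin L × Fin L, μ {ω | Far r (subBox x s) (subBox x t) ∧
      subBox x s ∈ A ω ∧ subBox x t ∈ A ω} ≤ q ^ 2 := by
    intro s t
    by_cases hst : Far r (subBox x s) (subBox x t)
    · simp only [hst, true_and, h.measure_inter hst, sq]
      exact mul_le_mul' (hq _) (hq _)
    · simp [hst]
  calc μ {ω | x ∈ coarsen r L (A ω)}
      = μ (⋃ s : Fin L × Fin L, ⋃ t : Fin L × Fin L, {ω | Far r (subBox x s) (subBox x t) ∧
          subBox x s ∈ A ω ∧ subBox x t ∈ A ω}) := by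
        congr 1
        ext ω
        simp [coarsen]
    _ ≤ ∑ _s : Fin L × Fin L, ∑ _t : Fin L × Fin L, q ^ 2 :=
        (measure_iUnion_fintype_le _ _).trans (Finset.sum_le_sum fun s _ =>
          (measure_iUnion_fintype_le _ _).trans (Finset.sum_le_sum fun t _ => pair s t))
    _ = (L : ℝ≥0∞) ^ 4 * q ^ 2 := by
        simp only [Finset.sum_const, Finset.card_univ, Fintype.card_prod, Fintype.card_fin,
          nsmul_eq_mul, Nat.cast_mul]
        ring

theorem IsDependent.measure_mem_iterate_coarsen_le (h : IsDependent r A μ) {q : ℝ≥0∞}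
    (hq : ∀ x, μ {ω | x ∈ A ω} ≤ q) (N : ℕ) (x : ℕ × ℕ) :
    (L : ℝ≥0∞) ^ 4 * μ {ω | x ∈ (coarsen r L)^[N] (A ω)} ≤
      ((L : ℝ≥0∞) ^ 4 * q) ^ 2 ^ N := by
  induction N generalizing A q with
  | zero => simpa using mul_le_mul_right (hq x) _
  | succ N ih =>
    calc _ ≤ ((L : ℝ≥0∞) ^ 4 * ((L : ℝ≥0∞) ^ 4 * q ^ 2)) ^ 2 ^ N :=
          ih (isDependent_coarsen h) fun x => h.measure_mem_coarsen_le hq x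
      _ = (((L : ℝ≥0∞) ^ 4 * q) ^ 2) ^ 2 ^ N := by ring
      _ = ((L : ℝ≥0∞) ^ 4 * q) ^ 2 ^ (N + 1) := by rw [← pow_mul, ← pow_succ' 2 N]

theorem IsDependent.measure_exists_subBox_mem_le (h : IsDependent r A μ) {q : ℝ≥0∞}
    (hq : ∀ x, μ {ω | x ∈ A ω} ≤ q) (N : ℕ) (x : ℕ × ℕ) :
    μ {ω | ∃ s : Fin L × Fin L, subBox x s ∈ (coarsen r L)^[N] (A ω)} ≤
      ((L : ℝ≥0∞) ^ 4 * q) ^ 2 ^ N := by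
  calc _ ≤ ∑ s : Fin L × Fin L,
          μ {ω | subBox x s ∈ (coarsen r L)^[N] (A ω)} := by
        rw [Set.ofPred_exists]
        exact measure_iUnion_fintype_le _ _
    _ ≤ ∑ _s : Fin L × Fin L, ((L : ℝ≥0∞) ^ 4 * q) ^ 2 ^ N / (L : ℝ≥0∞) ^ 2 := by
        refine Finset.sum_le_sum fun s _ => ?_
        have hL : 1 ≤ L := Fin.pos s.1
        rw [ENNReal.le_div_iff_mul_le (Or.inl (by positivity)) (Or.inl (by simp)), mul_comm]
        refine le_trans ?_ (h.measure_mem_iterate_coarsen_le hq N (subBox x s))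
        gcongr
        · exact_mod_cast hL
        · norm_num
    _ = (L : ℝ≥0∞) ^ 2 * (((L : ℝ≥0∞) ^ 4 * q) ^ 2 ^ N / (L : ℝ≥0∞) ^ 2) := by
        simp [sq]
    _ ≤ ((L : ℝ≥0∞) ^ 4 * q) ^ 2 ^ N := ENNReal.mul_div_le

theorem tsum_pow_two_pow_lt_one {θ : ℝ≥0∞} (hθ : θ < 2⁻¹) : ∑' N : ℕ, θ ^ 2 ^ N < 1 := by
  have hle : ∑' N : ℕ, θ ^ 2 ^ N ≤ ∑' N : ℕ, θ ^ (N + 1) := ENNReal.tsum_le_tsum fun N =>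
    pow_le_pow_right_of_le_one' (hθ.le.trans (by simp)) Nat.lt_two_pow_self
  refine hle.trans_lt ?_
  have hθ' : θ < 1 - θ := by
    rw [lt_tsub_iff_left, ← ENNReal.inv_two_add_inv_two]
    exact ENNReal.add_lt_add hθ hθ
  rw [ENNReal.tsum_geometric_add_one, ← div_eq_mul_inv]
  exact ENNReal.div_lt_of_lt_mul (by rwa [one_mul])

theorem IsDependent.measure_forall_notMem_pos [IsProbabilityMeasure μ] (h : IsDependent r A μ)
    {q : ℝ≥0∞} (hq : ∀ x, μ {ω | x ∈ A ω} ≤ q) (hLq : (L : ℝ≥0∞) ^ 4 * q < 2⁻¹) (x : ℕ × ℕ) :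
    0 < μ {ω | ∀ N, ∀ s : Fin L × Fin L,
      subBox x s ∉ (coarsen r L)^[N] (A ω)} := by
  set bad : ℕ → Set Ω := fun N =>
    {ω | ∃ s : Fin L × Fin L, subBox x s ∈ (coarsen r L)^[N] (A ω)}
  have hbad : μ (⋃ N, bad N) < 1 := by
    calc μ (⋃ N, bad N) ≤ ∑' N, μ (bad N) := measure_iUnion_le _
      _ ≤ ∑' N : ℕ, ((L : ℝ≥0∞) ^ 4 * q) ^ 2 ^ N :=
          ENNReal.tsum_le_tsum fun N => h.measure_exists_subBox_mem_le hq N x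
      _ < 1 := tsum_pow_two_pow_lt_one hLq
  have hcompl : {ω | ∀ N, ∀ s : Fin L × Fin L,
      subBox x s ∉ (coarsen r L)^[N] (A ω)} = (⋃ N, bad N)ᶜ := by
    ext ω
    simp [bad]
  rw [hcompl, pos_iff_ne_zero]
  intro h0
  have := measure_univ_le_add_compl (μ := μ) (⋃ N, bad N)
  rw [h0, add_zero, measure_univ] at this
  exact this.not_gt hbad

theorem isDependent_of_iIndepFun {J : Type*} {β : J → Type*} {mβ : ∀ j, MeasurableSpace (β j)}
    {X : ∀ j, Ω → β j} (hX : ∀ j, Measurable (X j)) (hind : iIndepFun X μ)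
    {S : ℕ × ℕ → Set J} (hS : ∀ x y, Far r x y → Disjoint (S x) (S y))
    (hA : ∀ x, Measurable[⨆ j ∈ S x, MeasurableSpace.comap (X j) (mβ j)] fun ω => x ∈ A ω) :
    IsDependent r A μ := by
  have trace : ∀ Z : Set (ℕ × ℕ),
      MeasurableSpace.comap (fun ω (z : Z) => (z : ℕ × ℕ) ∈ A ω) inferInstance ≤
        ⨆ j ∈ ⋃ z ∈ Z, S z, MeasurableSpace.comap (X j) (mβ j) := by
    intro Z
    refine Measurable.comap_le (@measurable_pi_lambda _ _ _ (_) _ _ fun z => ?_)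
    exact (hA z).mono (biSup_mono fun j hj => Set.mem_biUnion z.2 hj) le_rfl
  intro Y Z hYZ
  have hdisj : Disjoint (⋃ y ∈ Y, S y) (⋃ z ∈ Z, S z) := by
    simp only [Set.disjoint_iUnion_left, Set.disjoint_iUnion_right]
    exact fun z hz y hy => hS y z (hYZ y hy z hz)
  exact indep_of_indep_of_le_left (indep_of_indep_of_le_right
    (indep_iSup_of_disjoint (fun j => (hX j).comap_le) hind hdisj) (trace Z)) (trace Y)

end RandomBoxes

section OpenSubgraph

variable {V : Type*} {G : SimpleGraph V} {η : V → Bool} {x y : V}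

/-- The graph formed by the edges of `G` with two open endpoints; closed vertices are kept, as
isolated ones. -/
def openSubgraph (G : SimpleGraph V) (η : V → Bool) : SimpleGraph V where
  Adj x y := G.Adj x y ∧ η x = true ∧ η y = true
  symm := ⟨fun _ _ h => ⟨h.1.symm, h.2.symm⟩⟩
  loopless := ⟨fun _ h => h.1.ne rfl⟩

theorem openSubgraph_le : openSubgraph G η ≤ G := fun _ _ h => h.1

theorem forall_mem_support_eq_true (w : (openSubgraph G η).Walk x y) (hx : η x = true) :
    ∀ z ∈ w.support, η z = true := by
  induction w with
  | nil => simpa using hx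
  | cons h w ih => simpa [hx] using ih h.2.2

theorem reachable_openSubgraph_of_walk (w : G.Walk x y) (hw : ∀ z ∈ w.support, η z = true) :
    (openSubgraph G η).Reachable x y :=
  ⟨w.transfer _ fun e he => by
    induction e with
    | _ u v =>
      exact ⟨w.adj_of_mem_edges he, hw u (w.fst_mem_support_of_mem_edges he),
        hw v (w.snd_mem_support_of_mem_edges he)⟩⟩

/-- The open cluster of `x` in an arbitrary graph, with the convention of `cluster` that it is
empty if `x` is closed. -/
def openCluster (G : SimpleGraph V) (η : V → Bool) (x : V) : Set V :=
  {y | η x = true ∧ (openSubgraph G η).Reachable x y}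

theorem cluster_eq_openCluster {n : ℕ} (η : (Fin n → ℤ) → Bool) (x : Fin n → ℤ) :
    cluster η x = openCluster (lattice n) η x := by
  classical
  ext y
  constructor
  · rintro ⟨w, -, hw⟩
    exact ⟨hw x w.start_mem_support, reachable_openSubgraph_of_walk w hw⟩
  · rintro ⟨hx, ⟨w⟩⟩
    refine ⟨w.bypass.mapLe openSubgraph_le,
      (SimpleGraph.Walk.isPath_mapLe _).2 w.bypass_isPath, ?_⟩
    rw [SimpleGraph.Walk.support_mapLe_eq_support]
    exact forall_mem_support_eq_true _ hx

theorem measurableSet_forall_mem_list (l : List V) :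
    MeasurableSet {η : V → Bool | ∀ z ∈ l, η z = true} := by
  have : {η : V → Bool | ∀ z ∈ l, η z = true} =
      ⋂ z ∈ {z | z ∈ l}, {η : V → Bool | η z = true} := by
    ext η
    simp
  rw [this]
  exact MeasurableSet.biInter l.finite_toSet.countable fun z _ =>
    (measurable_pi_apply (X := fun _ : V => Bool) z) (MeasurableSet.singleton true)

theorem measurableSet_mem_cluster {n : ℕ} (x y : Fin n → ℤ) :
    MeasurableSet {η : (Fin n → ℤ) → Bool | y ∈ cluster η x} := by
  have : {η : (Fin n → ℤ) → Bool | y ∈ cluster η x} =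
      ⋃ l ∈ {l | ∃ w : (lattice n).Walk x y, w.IsPath ∧ w.support = l},
        {η | ∀ z ∈ l, η z = true} := by
    ext η
    simp [cluster]
  rw [this]
  exact MeasurableSet.biUnion (Set.to_countable _) fun l _ => measurableSet_forall_mem_list l

theorem measurableSet_originToInfinity (n : ℕ) : MeasurableSet (originToInfinity n) := by
  have : originToInfinity n =
      ⋂ s : Finset (Fin n → ℤ), ⋃ y ∈ {y | y ∉ s}, {η | y ∈ cluster η 0} := by
    ext η
    simp only [originToInfinity, Set.mem_ofPred_eq, Set.mem_iInter, Set.mem_iUnion, exists_prop]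
    refine ⟨fun h s => (h.exists_notMem_finset s).imp fun y hy => hy.symm, fun h hfin => ?_⟩
    obtain ⟨y, hy, hy'⟩ := h hfin.toFinset
    exact hy (hfin.mem_toFinset.2 hy')
  rw [this]
  exact MeasurableSet.iInter fun s => MeasurableSet.biUnion (Set.to_countable _) fun y _ =>
    measurableSet_mem_cluster 0 y

end OpenSubgraph

section OpenPaths

variable {V : Type*} {G H : SimpleGraph V} [G.LocallyFinite] {d : ℕ}

open Classical in
/-- The vertex sequences of the walks of length `m` in `G` which start at `x`. -/
noncomputable def walkSupports (G : SimpleGraph V) [G.LocallyFinite] : ℕ → V → Finset (List V)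
  | 0, x => {[x]}
  | m + 1, x => (G.neighborFinset x).biUnion fun y => (walkSupports G m y).image (x :: ·)

theorem support_mem_walkSupports {x y : V} (w : G.Walk x y) :
    w.support ∈ walkSupports G w.length x := by
  induction w with
  | nil => simp [walkSupports]
  | cons h w ih =>
    simp only [SimpleGraph.Walk.length_cons, SimpleGraph.Walk.support_cons, walkSupports,
      Finset.mem_biUnion, SimpleGraph.mem_neighborFinset, Finset.mem_image]
    exact ⟨_, h, _, ih, rfl⟩

theorem card_walkSupports_le (hd : ∀ x, G.degree x ≤ d) (m : ℕ) (x : V) :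
    (walkSupports G m x).card ≤ d ^ m := by
  induction m generalizing x with
  | zero => simp [walkSupports]
  | succ m ih =>
    classical
    calc (walkSupports G (m + 1) x).card ≤ G.degree x * d ^ m :=
          Finset.card_biUnion_le_card_mul _ _ _ fun y _ => Finset.card_image_le.trans (ih y)
      _ ≤ d ^ (m + 1) := by
          rw [pow_succ']
          exact Nat.mul_le_mul_right _ (hd x)

theorem exists_isPath_length_eq (hle : H ≤ G) {x : V} (hx : {y | H.Reachable x y}.Infinite)
    (m : ℕ) : ∃ (y : V) (w : H.Walk x y), w.IsPath ∧ w.length = m := by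
  classical
  by_contra! hm
  have length_lt : ∀ {y} (w : H.Walk x y), w.IsPath → w.length < m := fun w hw => by
    by_contra! hlen
    exact hm _ (w.take m) (hw.take m) (by simp [hlen])
  refine hx (((Finset.range m).biUnion fun j => walkSupports G j x).finite_toSet.image
    (fun l => l.getLastD x) |>.subset ?_)
  rintro y ⟨w⟩
  refine ⟨w.bypass.support, ?_, by simp [List.getLast?_eq_some_getLast w.bypass.support_ne_nil]⟩
  simp only [Finset.coe_biUnion, Set.mem_iUnion, Finset.mem_coe, Finset.mem_range, exists_prop]
  exact ⟨_, length_lt w.bypass w.bypass_isPath,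
    by simpa using support_mem_walkSupports (w.bypass.mapLe hle)⟩

end OpenPaths

section SitePercolation

variable {V : Type} {G : SimpleGraph V} [G.LocallyFinite] {d : ℕ}

theorem sitePerc_forall_mem_eq_true (V : Type) (p : unitInterval) (s : Finset V) :
    sitePerc V p {η | ∀ z ∈ s, η z = true} = ENNReal.ofReal p ^ s.card := by
  have hset : {η : V → Bool | ∀ z ∈ s, η z = true} = Set.pi s fun _ => {true} := by
    ext η
    simp [Set.mem_pi]
  rw [hset, sitePerc, Measure.infinitePi_pi _ fun _ _ => MeasurableSet.singleton true,
    Finset.prod_const, ← bernoulliMeasure_real_apply_of_mem_of_notMem (x := true) (y := false) p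
    (MeasurableSet.singleton true) (by simp) (by simp), ofReal_measureReal]

theorem sitePerc_exists_isPath_le (hd : ∀ x, G.degree x ≤ d) (p : unitInterval) (x : V) (m : ℕ) :
    sitePerc V p {η | η x = true ∧
      ∃ (y : V) (w : (openSubgraph G η).Walk x y), w.IsPath ∧ w.length = m} ≤
      (d * ENNReal.ofReal p) ^ m := by
  classical
  calc _ ≤ sitePerc V p (⋃ l ∈ (walkSupports G m x).filter fun l => l.Nodup ∧ l.length = m + 1,
          {η | ∀ z ∈ l.toFinset, η z = true}) := by
        refine measure_mono ?_
        rintro η ⟨hx, y, w, hw, rfl⟩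
        have hsupport : w.support ∈ walkSupports G w.length x := by
          simpa using support_mem_walkSupports (w.mapLe openSubgraph_le)
        simp only [Set.mem_iUnion, Finset.mem_filter, List.mem_toFinset]
        exact ⟨w.support, ⟨hsupport, hw.support_nodup, w.length_support⟩,
          forall_mem_support_eq_true w hx⟩
    _ ≤ ∑ _l ∈ (walkSupports G m x).filter fun l => l.Nodup ∧ l.length = m + 1,
          ENNReal.ofReal p ^ m := by
        refine (measure_biUnion_finset_le _ _).trans (Finset.sum_le_sum fun l hl => ?_)
        obtain ⟨-, hnodup, hlength⟩ := Finset.mem_filter.1 hl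
        rw [sitePerc_forall_mem_eq_true, List.toFinset_card_of_nodup hnodup, hlength]
        exact pow_le_pow_right_of_le_one' (ENNReal.ofReal_le_one.2 p.2.2) m.le_succ
    _ ≤ (d * ENNReal.ofReal p) ^ m := by
        rw [Finset.sum_const, nsmul_eq_mul, mul_pow]
        gcongr
        exact_mod_cast (Finset.card_filter_le _ _).trans (card_walkSupports_le hd m x)

theorem sitePerc_infinite_openCluster_eq_zero (hd : ∀ x, G.degree x ≤ d) {p : unitInterval}
    (hp : d * ENNReal.ofReal p < 1) (x : V) :
    sitePerc V p {η | (openCluster G η x).Infinite} = 0 := by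
  have bound : ∀ m, sitePerc V p {η | (openCluster G η x).Infinite} ≤
      (d * ENNReal.ofReal p) ^ m := fun m => by
    refine (measure_mono fun η hη => ?_).trans (sitePerc_exists_isPath_le hd p x m)
    obtain ⟨-, hx, -⟩ := hη.nonempty
    exact ⟨hx, exists_isPath_length_eq openSubgraph_le (hη.mono fun _ hy => hy.2) m⟩
  exact le_antisymm
    (ge_of_tendsto' (ENNReal.tendsto_pow_atTop_nhds_zero_of_lt_one hp) bound) zero_le

end SitePercolation

section Planes

variable {n k : ℕ}

/-- The nearest-neighbour lattice on a coordinate plane. -/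
def planeLattice (I : Finset (Fin n)) : SimpleGraph (CoordPlane I) :=
  (lattice n).comap Subtype.val

theorem mem_Icc_of_lattice_adj {x y : Fin n → ℤ} (h : (lattice n).Adj x y) :
    y ∈ Finset.Icc (x - 1) (x + 1) := by
  have near : ∀ i, |x i - y i| ≤ 1 := fun i => by
    have h : ∑ i, |x i - y i| = 1 := h
    exact h ▸ Finset.single_le_sum (f := fun i => |x i - y i|) (fun _ _ => abs_nonneg _)
      (Finset.mem_univ i)
  refine Finset.mem_Icc.2 ⟨fun i => ?_, fun i => ?_⟩ <;>
    simp only [Pi.sub_apply, Pi.add_apply, Pi.one_apply] <;> linarith [abs_le.1 (near i)]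

noncomputable instance (I : Finset (Fin n)) : (planeLattice I).LocallyFinite := fun x =>
  (Set.Finite.subset ((Finset.Icc (x.1 - 1) (x.1 + 1)).finite_toSet.preimage
    Subtype.val_injective.injOn) fun _ h => mem_Icc_of_lattice_adj h).fintype

theorem degree_planeLattice_le (I : Finset (Fin n)) (x : CoordPlane I) :
    (planeLattice I).degree x ≤ 3 ^ n := by
  have hcard : (Finset.Icc (x.1 - 1) (x.1 + 1)).card = 3 ^ n := by
    rw [Pi.card_Icc]
    simp [show ∀ a : ℤ, (a + 1 + 1 - (a - 1)).toNat = 3 by intro a; ring_nf; rfl]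
  rw [← hcard]
  exact Finset.card_le_card_of_injOn Subtype.val
    (fun y hy => mem_Icc_of_lattice_adj (((planeLattice I).mem_neighborFinset x y).1 hy))
    Subtype.val_injective.injOn

theorem proj_eq_or_planeLattice_adj (I : Finset (Fin n)) {x y : Fin n → ℤ}
    (h : (lattice n).Adj x y) :
    proj I x = proj I y ∨ (planeLattice I).Adj (proj I x) (proj I y) := by
  refine or_iff_not_imp_left.2 fun hne => ?_
  have hle : ∑ i, |(proj I x).1 i - (proj I y).1 i| ≤ 1 := by
    have h : ∑ i, |x i - y i| = 1 := h
    rw [← h]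
    refine Finset.sum_le_sum fun i _ => ?_
    by_cases hi : i ∈ I <;> simp [proj, hi]
  obtain ⟨i, hi⟩ : ∃ i, (proj I x).1 i ≠ (proj I y).1 i := by
    by_contra! h0
    exact hne (Subtype.ext (funext h0))
  have hge : 1 ≤ ∑ i, |(proj I x).1 i - (proj I y).1 i| :=
    (Int.one_le_abs (sub_ne_zero.2 hi)).trans (Finset.single_le_sum
      (f := fun i => |(proj I x).1 i - (proj I y).1 i|) (fun j _ => abs_nonneg _)
      (Finset.mem_univ i))
  exact le_antisymm hle hge

theorem apply_proj_eq_true {ω : (I : Index n k) → CoordPlane I.1 → Bool} {v : Fin n → ℤ}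
    (h : config ω v = true) (I : Index n k) : ω I (proj I.1 v) = true :=
  of_decide_eq_true h I

theorem proj_mem_openCluster {ω : (I : Index n k) → CoordPlane I.1 → Bool} {x y : Fin n → ℤ}
    (h : y ∈ cluster (config ω) x) (I : Index n k) :
    proj I.1 y ∈ openCluster (planeLattice I.1) (ω I) (proj I.1 x) := by
  rw [cluster_eq_openCluster] at h
  refine ⟨apply_proj_eq_true h.1 I, ?_⟩
  obtain ⟨w⟩ := h.2
  induction w with
  | nil => exact .refl _
  | cons hadj w ih =>
    refine SimpleGraph.Reachable.trans ?_ (ih ⟨hadj.2.2, ⟨w⟩⟩)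
    rcases proj_eq_or_planeLattice_adj I.1 hadj.1 with heq | hplane
    · rw [heq]
    · exact SimpleGraph.Adj.reachable
        ⟨hplane, apply_proj_eq_true hadj.2.1 I, apply_proj_eq_true hadj.2.2 I⟩

theorem exists_infinite_image_proj (hk : 0 < k) (hkn : k ≤ n) {S : Set (Fin n → ℤ)}
    (hS : S.Infinite) : ∃ I : Index n k, (proj I.1 '' S).Infinite := by
  obtain ⟨i, hi⟩ : ∃ i : Fin n, ((fun v : Fin n → ℤ => v i) '' S).Infinite := by
    by_contra! hfin
    exact hS ((Set.Finite.pi' hfin).subset fun v hv i => ⟨v, hv, rfl⟩)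
  obtain ⟨I, hiI, hIk⟩ := Finset.exists_superset_card_eq (s := {i}) (n := k)
    (by simpa using Nat.succ_le_of_lt hk) (by simpa using hkn)
  refine ⟨⟨I, hIk⟩, Set.Infinite.of_image (fun u : CoordPlane I => u.1 i) ?_⟩
  rw [Set.image_image]
  simpa [proj, hiI (Finset.mem_singleton_self i)] using hi

theorem law_originToInfinity_eq_zero (hk : 0 < k) (hkn : k ≤ n) {p : Index n k → unitInterval}
    (hp : ∀ I, (p I : ℝ) < (3 ^ n)⁻¹) : law p (originToInfinity n) = 0 := by
  rw [law, Measure.map_apply measurable_config (measurableSet_originToInfinity n)]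
  refine measure_mono_null (t := ⋃ I : Index n k, Function.eval I ⁻¹'
    {η | (openCluster (planeLattice I.1) η (proj I.1 0)).Infinite}) (fun ω hω => ?_)
    (measure_iUnion_null fun I => ?_)
  · obtain ⟨I, hI⟩ := exists_infinite_image_proj hk hkn hω
    exact Set.mem_iUnion.2 ⟨I, hI.mono (Set.image_subset_iff.2 fun y hy =>
      proj_mem_openCluster hy I)⟩
  · refine (measurePreserving_eval (fun I : Index n k => sitePerc (CoordPlane I.1) (p I))
      I).quasiMeasurePreserving.preimage_null
      (sitePerc_infinite_openCluster_eq_zero (degree_planeLattice_le I.1) ?_ _)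
    have hp' := hp I
    rw [← one_div, lt_div_iff₀ (by positivity)] at hp'
    rw [← ENNReal.ofReal_natCast, ← ENNReal.ofReal_mul (by positivity), ENNReal.ofReal_lt_one]
    push_cast
    linarith

theorem exists_forall_law_originToInfinity_eq_zero (hk : 0 < k) (hkn : k ≤ n) :
    ∃ ε : ℝ, 0 < ε ∧ ∀ p : Index n k → unitInterval, (∀ I, (p I : ℝ) < ε) →
      law p (originToInfinity n) = 0 :=
  ⟨(3 ^ n)⁻¹, by positivity, fun _ => law_originToInfinity_eq_zero hk hkn⟩

end Planes

section Cells

variable {n k : ℕ}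

/-- The corner of a cell: the lattice point `a • (1, …, 1) + b • (0, 1, …, n - 1)`. Any two
coordinates of it determine `(a, b)`. -/
def corner (n : ℕ) (c : ℕ × ℕ) : Fin n → ℤ := fun i => c.1 + c.2 * (i : ℕ)

/-- The sites of a cell, relative to its corner; the side length is such that the cube contains
the differences of the corners of neighbouring cells. -/
noncomputable def cube (n : ℕ) : Finset (Fin n → ℤ) := Finset.Icc 0 fun _ => (n : ℤ)

/-- The cells with a closed site. -/
def closedCells (ω : (I : Index n k) → CoordPlane I.1 → Bool) : Set (ℕ × ℕ) :=
  {c | ∃ v ∈ cube n, config ω (corner n c + v) = false}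

/-- The variables `ω_I(u)`, indexed by the pairs `(I, u)`, on which the state of a cell depends. -/
def cellSites (n k : ℕ) (c : ℕ × ℕ) : Set (Σ I : Index n k, CoordPlane I.1) :=
  {j | ∃ v ∈ cube n, j.2 = proj j.1.1 (corner n c + v)}

/-- Cells at distance more than this depend on disjoint sets of variables. -/
def dependenceRange (n : ℕ) : ℕ := 2 * n * n + n

theorem mem_cube {v : Fin n → ℤ} : v ∈ cube n ↔ ∀ i, 0 ≤ v i ∧ v i ≤ n := by
  simp [cube, Pi.le_def, forall_and]

theorem setOf_mem_closedCells (n k : ℕ) (c : ℕ × ℕ) :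
    {ω : (I : Index n k) → CoordPlane I.1 → Bool | c ∈ closedCells ω} =
      ⋃ I, ⋃ v ∈ cube n, {ω | ω I (proj I.1 (corner n c + v)) = false} := by
  ext ω
  simp only [closedCells, config, Set.mem_ofPred_eq, decide_eq_false_iff_not, not_forall,
    Bool.not_eq_true, Set.mem_iUnion, exists_prop]
  exact ⟨fun ⟨v, hv, I, h⟩ => ⟨I, v, hv, h⟩, fun ⟨I, v, hv, h⟩ => ⟨v, hv, I, h⟩⟩

theorem config_eq_true_of_notMem_closedCells {ω : (I : Index n k) → CoordPlane I.1 → Bool}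
    {c : ℕ × ℕ} (hc : c ∉ closedCells ω) {v : Fin n → ℤ} (hv : v ∈ cube n) :
    config ω (corner n c + v) = true :=
  Bool.eq_true_of_not_eq_false fun h => hc ⟨v, hv, h⟩

theorem corner_zero : corner n 0 = 0 := by
  ext i
  simp [corner]

theorem corner_injective (hn : 2 ≤ n) : Function.Injective (corner n) := by
  intro c c' h
  have h₀ := congrFun h ⟨0, by omega⟩
  have h₁ := congrFun h ⟨1, by omega⟩
  simp only [corner] at h₀ h₁
  exact Prod.ext (by omega) (by omega)

theorem corner_right (a b : ℕ) : corner n (a + 1, b) = corner n (a, b) + fun _ => 1 := by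
  ext i
  simp only [corner, Pi.add_apply]
  push_cast
  ring

theorem corner_up (a b : ℕ) :
    corner n (a, b + 1) = corner n (a, b) + fun i : Fin n => ((i : ℕ) : ℤ) := by
  ext i
  simp only [corner, Pi.add_apply]
  push_cast
  ring

theorem lattice_adj_sub_single (x : Fin n → ℤ) (i : Fin n) :
    (lattice n).Adj (x - Pi.single i 1) x := by
  change ∑ j, |(x - Pi.single i 1 : Fin n → ℤ) j - x j| = 1
  simp [Pi.single_apply, apply_ite abs]

theorem reachable_add_of_mem_cube {η : (Fin n → ℤ) → Bool} {b : Fin n → ℤ}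
    (hopen : ∀ v ∈ cube n, η (b + v) = true) {v : Fin n → ℤ} (hv : v ∈ cube n) :
    (openSubgraph (lattice n) η).Reachable b (b + v) := by
  induction hm : (∑ i, v i).toNat generalizing v with
  | zero =>
    have hzero := (Finset.sum_eq_zero_iff_of_nonneg fun i _ => (mem_cube.1 hv i).1).1
      (le_antisymm (Int.toNat_eq_zero.1 hm) (Finset.sum_nonneg fun i _ => (mem_cube.1 hv i).1))
    rw [show v = 0 from funext fun i => hzero i (Finset.mem_univ i), add_zero]
  | succ m ih =>
    obtain ⟨i, -, hi⟩ : ∃ i ∈ Finset.univ, 0 < v i := by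
      refine Finset.exists_lt_of_sum_lt (f := 0) ?_
      simp only [Pi.zero_apply, Finset.sum_const_zero]
      omega
    have hv' : v - Pi.single i 1 ∈ cube n := by
      refine mem_cube.2 fun j => ?_
      have := mem_cube.1 hv j
      rcases eq_or_ne j i with rfl | hj
      · simp only [Pi.sub_apply, Pi.single_eq_same]
        omega
      · simpa [Pi.single_eq_of_ne hj] using this
    have hadj : (lattice n).Adj (b + (v - Pi.single i 1)) (b + v) := by
      simpa only [add_sub_assoc] using lattice_adj_sub_single (b + v) i
    refine (ih hv' ?_).trans (SimpleGraph.Adj.reachable ⟨hadj, hopen _ hv', hopen _ hv⟩)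
    simp only [Pi.sub_apply, Finset.sum_sub_distrib, Finset.sum_pi_single', Finset.mem_univ,
      if_true]
    omega

theorem linksNeighbours_closedCells (ω : (I : Index n k) → CoordPlane I.1 → Bool) :
    LinksNeighbours ((openSubgraph (lattice n) (config ω)).reachableSetoid.comap (corner n))
      (closedCells ω) := by
  have within_cell : ∀ {c : ℕ × ℕ}, c ∉ closedCells ω → ∀ v ∈ cube n,
      (openSubgraph (lattice n) (config ω)).Reachable (corner n c) (corner n c + v) :=
    fun hc _ hv => reachable_add_of_mem_cube
      (fun _ => config_eq_true_of_notMem_closedCells hc) hv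
  refine ⟨fun a b h _ => ?_, fun a b h _ => ?_⟩
  · have hv : (fun _ => 1) ∈ cube n := mem_cube.2 fun i => by
      have := i.2
      omega
    change (openSubgraph (lattice n) (config ω)).Reachable (corner n (a, b)) (corner n (a + 1, b))
    rw [corner_right]
    exact within_cell h _ hv
  · have hv : (fun i : Fin n => ((i : ℕ) : ℤ)) ∈ cube n := mem_cube.2 fun i => by
      have := i.2
      omega
    change (openSubgraph (lattice n) (config ω)).Reachable (corner n (a, b)) (corner n (a, b + 1))
    rw [corner_up]
    exact within_cell h _ hv

theorem infinite_cluster_of_forall_notMem (hn : 2 ≤ n) {L : ℕ} (hL : 2 * dependenceRange n + 3 ≤ L)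
    {ω : (I : Index n k) → CoordPlane I.1 → Bool} (hgood : ∀ N, ∀ s : Fin L × Fin L,
      subBox 0 s ∉ (coarsen (dependenceRange n) L)^[N] (closedCells ω)) :
    (cluster (config ω) 0).Infinite := by
  have horigin : (0 : ℕ × ℕ) ∉ closedCells ω := by
    simpa [subBox, ← Prod.zero_eq_mk] using
      hgood 0 ((⟨0, by omega⟩ : Fin L), (⟨0, by omega⟩ : Fin L))
  have hopen : config ω (0 : Fin n → ℤ) = true := by
    simpa [corner_zero] using config_eq_true_of_notMem_closedCells horigin
      (v := 0) (mem_cube.2 fun i => by simp)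
  have hinf := infinite_setOf_rel_zero hL (linksNeighbours_closedCells ω) hgood
  refine (hinf.image (corner_injective hn).injOn).mono ?_
  rintro _ ⟨c, hc, rfl⟩
  rw [cluster_eq_openCluster]
  have hreach : (openSubgraph (lattice n) (config ω)).Reachable (corner n 0) (corner n c) := hc
  exact ⟨hopen, by rwa [corner_zero] at hreach⟩

end Cells

section CellDependence

open scoped ENNReal

variable {n k : ℕ}

theorem abs_le_and_abs_le_of_abs_add_mul_le {a b s t m : ℤ} (hs : 0 ≤ s) (hst : s < t) (htm : t ≤ m)
    (has : |a + b * s| ≤ m) (hat : |a + b * t| ≤ m) : |a| ≤ 2 * m * m + m ∧ |b| ≤ 2 * m := by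
  have hb : |b| ≤ 2 * m := calc
    |b| ≤ |b| * |t - s| := le_mul_of_one_le_right (abs_nonneg b) (by rw [abs_of_pos] <;> omega)
    _ = |(a + b * t) - (a + b * s)| := by rw [← abs_mul]; ring_nf
    _ ≤ |a + b * t| + |a + b * s| := abs_sub _ _
    _ ≤ 2 * m := by omega
  refine ⟨?_, hb⟩
  calc |a| = |(a + b * s) - b * s| := by ring_nf
    _ ≤ |a + b * s| + |b| * |s| := by rw [← abs_mul]; exact abs_sub _ _
    _ ≤ m + 2 * m * m := by
      rw [abs_of_nonneg hs]
      exact add_le_add has (mul_le_mul hb (by omega) hs (by omega))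
    _ = 2 * m * m + m := by ring

theorem cast_dist (a b : ℕ) : (Nat.dist a b : ℤ) = |(a : ℤ) - b| := by
  rcases le_total a b with h | h
  · rw [Nat.dist_eq_sub_of_le h, Nat.cast_sub h, abs_sub_comm, abs_of_nonneg (by omega)]
  · rw [Nat.dist_eq_sub_of_le_right h, Nat.cast_sub h, abs_of_nonneg (by omega)]

theorem disjoint_cellSites (hk : 2 ≤ k) {c c' : ℕ × ℕ} (h : Far (dependenceRange n) c c') :
    Disjoint (cellSites n k c) (cellSites n k c') := by
  rw [Set.disjoint_left]
  rintro ⟨I, u⟩ ⟨v, hv, hu⟩ ⟨w, hw, hu'⟩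
  have heq := hu.symm.trans hu'
  have abs_corner_sub_le : ∀ i ∈ I.1,
      |((c.1 : ℤ) - c'.1) + ((c.2 : ℤ) - c'.2) * (i : ℕ)| ≤ n := by
    intro i hi
    have hcoord : corner n c i + v i = corner n c' i + w i := by
      simpa [proj, hi] using congrFun (congrArg Subtype.val heq) i
    have hvi := mem_cube.1 hv i
    have hwi := mem_cube.1 hw i
    simp only [corner] at hcoord
    rw [abs_le]
    constructor <;> linarith
  have not_lt : ∀ i ∈ I.1, ∀ j ∈ I.1, ¬ i < j := by
    intro i hi j hj hij
    obtain ⟨h₁, h₂⟩ := abs_le_and_abs_le_of_abs_add_mul_le (by positivity)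
      (by exact_mod_cast hij) (by exact_mod_cast j.2.le) (abs_corner_sub_le i hi)
      (abs_corner_sub_le j hj)
    rw [← cast_dist] at h₁ h₂
    norm_cast at h₁ h₂
    have hn : 2 * n ≤ dependenceRange n := by
      have := j.2
      unfold dependenceRange
      nlinarith
    exact h.elim h₁.not_gt (h₂.trans hn).not_gt
  obtain ⟨i, hi, j, hj, hij⟩ := Finset.one_lt_card.1 (show 1 < I.1.card by rw [I.2]; omega)
  exact hij.lt_or_gt.elim (not_lt i hi j hj) (not_lt j hj i hi)

/-- The joint law of the percolations on the coordinate planes. -/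
noncomputable abbrev fieldLaw (p : Index n k → unitInterval) :
    Measure ((I : Index n k) → CoordPlane I.1 → Bool) :=
  Measure.pi fun I : Index n k => sitePerc (CoordPlane I.1) (p I)

theorem iIndepFun_fieldLaw (p : Index n k → unitInterval) :
    iIndepFun (fun (j : Σ I : Index n k, CoordPlane I.1)
      (ω : (I : Index n k) → CoordPlane I.1 → Bool) => ω j.1 j.2) (fieldLaw p) := by
  rw [fieldLaw, ← Measure.infinitePi_eq_pi]
  exact iIndepFun_uncurry_infinitePi (X := fun _ _ b => b)
    (fun (I : Index n k) (_ : CoordPlane I.1) => bernoulliMeasure true false (p I))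
    fun _ _ => measurable_id

theorem fieldLaw_closed (p : Index n k → unitInterval) (I : Index n k) (u : CoordPlane I.1) :
    fieldLaw p {ω | ω I u = false} = ENNReal.ofReal (1 - p I) := by
  have hpreserving := (measurePreserving_eval_infinitePi
      (fun _ : CoordPlane I.1 => bernoulliMeasure true false (p I)) u).comp
    (measurePreserving_eval (fun I : Index n k => sitePerc (CoordPlane I.1) (p I)) I)
  refine (hpreserving.measure_preimage (MeasurableSet.singleton false).nullMeasurableSet).trans ?_
  rw [← bernoulliMeasure_real_apply_of_notMem_of_mem (x := true) (y := false) (p I)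
    (MeasurableSet.singleton false) (by simp) (by simp), ofReal_measureReal]

theorem isDependent_closedCells (hk : 2 ≤ k) (p : Index n k → unitInterval) :
    IsDependent (dependenceRange n) (closedCells (n := n) (k := k)) (fieldLaw p) := by
  refine isDependent_of_iIndepFun (S := cellSites n k) (fun j => ?_) (iIndepFun_fieldLaw p)
    (fun _ _ => disjoint_cellSites hk) fun c => ?_
  · exact (measurable_pi_apply j.2).comp (measurable_pi_apply j.1)
  · refine (@measurableSet_setOfPred _ (_) _).1 ?_
    rw [setOf_mem_closedCells]
    refine MeasurableSet.iUnion fun I => Finset.measurableSet_biUnion _ fun v hv => ?_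
    exact le_biSup (fun j : Σ I : Index n k, CoordPlane I.1 => MeasurableSpace.comap
      (fun ω : (I : Index n k) → CoordPlane I.1 → Bool => ω j.1 j.2) inferInstance)
      (show ⟨I, proj I.1 (corner n c + v)⟩ ∈ cellSites n k c from ⟨v, hv, rfl⟩) _
      ⟨{false}, MeasurableSet.singleton false, rfl⟩

theorem fieldLaw_mem_closedCells_le {p : Index n k → unitInterval} {ε : ℝ}
    (hp : ∀ I, 1 - ε < (p I : ℝ)) (c : ℕ × ℕ) :
    fieldLaw p {ω | c ∈ closedCells ω} ≤
      ENNReal.ofReal ε * (Fintype.card (Index n k) * (cube n).card : ℕ) := by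
  calc fieldLaw p {ω | c ∈ closedCells ω}
      ≤ ∑ _I : Index n k, ∑ _v ∈ cube n, ENNReal.ofReal ε := by
        rw [setOf_mem_closedCells]
        refine (measure_iUnion_fintype_le _ _).trans (Finset.sum_le_sum fun I _ => ?_)
        refine (measure_biUnion_finset_le _ _).trans (Finset.sum_le_sum fun v _ => ?_)
        rw [fieldLaw_closed]
        exact ENNReal.ofReal_le_ofReal (by linarith [hp I])
    _ = ENNReal.ofReal ε * (Fintype.card (Index n k) * (cube n).card : ℕ) := by
        simp only [Finset.sum_const, Finset.card_univ, nsmul_eq_mul, Nat.cast_mul]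
        ring

theorem exists_forall_law_originToInfinity_pos (hn : 2 ≤ n) (hk : 2 ≤ k) :
    ∃ ε : ℝ, 0 < ε ∧ ∀ p : Index n k → unitInterval, (∀ I, 1 - ε < (p I : ℝ)) →
      0 < law p (originToInfinity n) := by
  let L := 2 * dependenceRange n + 3
  obtain ⟨ε, hε, hsmall⟩ := ENNReal.exists_nnreal_pos_mul_lt
    (a := (Fintype.card (Index n k) * (cube n).card : ℕ) * (L : ℝ≥0∞) ^ 4) (b := 2⁻¹)
    (by finiteness) (by simp)
  refine ⟨ε, hε, fun p hp => ?_⟩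
  have hgood := (isDependent_closedCells hk p).measure_forall_notMem_pos (L := L)
    (fieldLaw_mem_closedCells_le hp) (by
      rw [ENNReal.ofReal_coe_nnreal]
      convert hsmall using 1
      ring) 0
  calc 0 < _ := hgood
    _ ≤ fieldLaw p (config ⁻¹' originToInfinity n) :=
        measure_mono fun ω hω => infinite_cluster_of_forall_notMem hn le_rfl hω
    _ ≤ law p (originToInfinity n) := Measure.le_map_apply measurable_config.aemeasurable _

end CellDependence

theorem nontrivialPhaseTransition_of_thresholds {n k : ℕ}
    (hsup : ∃ ε : ℝ, 0 < ε ∧ ∀ p : Index n k → unitInterval, (∀ I, 1 - ε < (p I : ℝ)) →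
      0 < law p (originToInfinity n))
    (hsub : ∃ ε : ℝ, 0 < ε ∧ ∀ p : Index n k → unitInterval, (∀ I, (p I : ℝ) < ε) →
      law p (originToInfinity n) = 0) :
    NontrivialPhaseTransition n k := by
  have exists_pos_lt : ∀ {ε : ℝ}, 0 < ε → ∃ t : unitInterval, 0 < t ∧ (t : ℝ) < ε := by
    intro ε hε
    have hpos : 0 < min (ε / 2) 1 := by positivity
    exact ⟨⟨min (ε / 2) 1, hpos.le, min_le_right _ _⟩, hpos,
      (min_le_left _ _).trans_lt (by linarith)⟩
  obtain ⟨ε, hε, hsup⟩ := hsup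
  obtain ⟨δ, hδ, hsub⟩ := hsub
  obtain ⟨s, hs, hsε⟩ := exists_pos_lt hε
  obtain ⟨t, ht, htδ⟩ := exists_pos_lt hδ
  refine ⟨⟨fun _ => t, fun _ => ht, hsub _ fun _ => htδ⟩,
    ⟨fun _ => unitInterval.symm s, fun _ => ?_, hsup _ fun _ => ?_⟩⟩
  · exact unitInterval.symm_lt_comm.1 (by simpa using hs)
  · simpa using hsε

end HyperplanePercolation

theorem theoremt_general (n k : ℕ) (hk : 2 ≤ k) (hkn : k ≤ n) :
    HyperplanePercolation.NontrivialPhaseTransition n k ∧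
    (∃ ε : ℝ, 0 < ε ∧ ∀ p : HyperplanePercolation.Index n k → unitInterval,
      (∀ I, 1 - ε < (p I : ℝ)) →
        0 < HyperplanePercolation.law p (HyperplanePercolation.originToInfinity n)) ∧
    (∃ ε : ℝ, 0 < ε ∧ ∀ p : HyperplanePercolation.Index n k → unitInterval,
      (∀ I, (p I : ℝ) < ε) →
        HyperplanePercolation.law p (HyperplanePercolation.originToInfinity n) = 0) :=
  have hsup := HyperplanePercolation.exists_forall_law_originToInfinity_pos (hk.trans hkn) hk
  have hsub := HyperplanePercolation.exists_forall_law_originToInfinity_eq_zero (by omega) hkn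
  ⟨HyperplanePercolation.nontrivialPhaseTransition_of_thresholds hsup hsub, hsup, hsub⟩

theorem theoremt (n k : ℕ) (hn : 3 ≤ n) (hk : 2 ≤ k) (hkn : k ≤ n - 1) :
    HyperplanePercolation.NontrivialPhaseTransition n k ∧
    (∃ ε : ℝ, 0 < ε ∧ ∀ p : HyperplanePercolation.Index n k → unitInterval,
      (∀ I, 1 - ε < (p I : ℝ)) →
        0 < HyperplanePercolation.law p (HyperplanePercolation.originToInfinity n)) ∧
    (∃ ε : ℝ, 0 < ε ∧ ∀ p : HyperplanePercolation.Index n k → unitInterval,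
      (∀ I, (p I : ℝ) < ε) →
        HyperplanePercolation.law p (HyperplanePercolation.originToInfinity n) = 0) :=
  theoremt_general n k hk (by omega)
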